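/- All Banach spaces are real, $B_X$ is the closed unit ball of $X$, $X^*$ is the dual of $X$, and for a subspace $Y$ of $X$ we put $Y^\perp=\{f\in X^* : f|_Y=0\}$. A slice of $B_X$ is a set $S(f,\varepsilon)=\{x\in B_X : f(x)>1-\varepsilon\}$ with $f\in X^*$, $\|f\|=1$, $\varepsilon>0$. A Banach space $X$ has the *strong diameter 2 property* if every finite convex combination $\sum_{i=1}^n\lambda_i S(f_i,\varepsilon_i)$ of slices of $B_X$ ($\lambda_i\ge 0$, $\sum_{i=1}^n\lambda_i=1$) has diameter $2$. We write $X^*=Z\oplus_1 Y^\perp$ if $Z$ is a linear subspace of $X^*$ with $X^*=Z\oplus Y^\perp$ and $\|z+w\|=\|z\|+\|w\|$ for all $z\in Z$, $w\in Y^\perp$; a closed subspace $Y$ of $X$ is an *M-ideal* in $X$ if such a $Z$ exists, and it is *proper* if $Y\ne X$. A subspace $Z$ of $X^*$ is *1-norming* for $X$ if $\|x\|=\sup\{|f(x)| : f\in Z,\ \|f\|\le 1\}$ for all $x\in X$. A Banach space $X$ is *M-embedded* if its canonical image is an M-ideal in $X^{**}$, and *proper M-embedded* if, in addition, this image is not all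 of $X^{**}$. **Theorem.** Let $X$ be a Banach space. 1. Let $Y$ be a proper M-ideal in $X$, with $X^*=Z\oplus_1 Y^\perp$ for a subspace $Z$ of $X^*$. If $Z$ is 1-norming for $X$, then both $X$ and $Y$ have the strong diameter 2 property. 2. If $X$ is proper M-embedded, then both $X$ and $X^{**}$ have the strong diameter 2 property. -/

import Mathlib

/-- The annihilator `Y^⊥ = {f ∈ X* : f = 0 on Y}` of a subspace `Y` of `X`. -/
def topAnnihilator {X : Type*} [NormedAddCommGroup X] [NormedSpace ℝ X]
    (Y : Submodule ℝ X) : Submodule ℝ (StrongDual ℝ X) where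
  carrier := {f | ∀ y ∈ Y, f y = 0}
  add_mem' := by
    intro f g hf hg y hy
    simp [hf y hy, hg y hy]
  zero_mem' := by
    intro y _
    simp
  smul_mem' := by
    intro c f hf y hy
    simp [hf y hy]

/-- `E = Z ⊕₁ W`: the subspaces `Z` and `W` are algebraic complements of each other in `E` and the
norm is additive on the sum. -/
def IsLSum {E : Type*} [NormedAddCommGroup E] [NormedSpace ℝ E] (Z W : Submodule ℝ E) : Prop :=
  IsCompl Z W ∧ ∀ z ∈ Z, ∀ w ∈ W, ‖z + w‖ = ‖z‖ + ‖w‖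

/-- A closed subspace `Y` of `X` is an M-ideal in `X` if `Y^⊥` is an L-summand in `X*`. -/
def IsMIdeal {X : Type*} [NormedAddCommGroup X] [NormedSpace ℝ X] (Y : Submodule ℝ X) : Prop :=
  IsClosed (Y : Set X) ∧ ∃ Z : Submodule ℝ (StrongDual ℝ X), IsLSum Z (topAnnihilator Y)

/-- The canonical image of `X` in its bidual `X**`. -/
noncomputable def canonicalImage (X : Type*) [NormedAddCommGroup X] [NormedSpace ℝ X] :
    Submodule ℝ (StrongDual ℝ (StrongDual ℝ X)) :=
  LinearMap.range (NormedSpace.inclusionInDoubleDual ℝ X).toLinearMap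

/-- `X` is M-embedded if it is an M-ideal in its bidual. -/
def IsMEmbedded (X : Type*) [NormedAddCommGroup X] [NormedSpace ℝ X] : Prop :=
  IsMIdeal (X := StrongDual ℝ (StrongDual ℝ X)) (canonicalImage X)

/-- A subspace `Z` of `X*` is 1-norming for `X` if `‖x‖ = sup {|f x| : f ∈ Z, ‖f‖ ≤ 1}` for all
`x ∈ X`. -/
def IsOneNorming {X : Type*} [NormedAddCommGroup X] [NormedSpace ℝ X]
    (Z : Submodule ℝ (StrongDual ℝ X)) : Prop :=
  ∀ x : X, IsLUB {t : ℝ | ∃ f ∈ Z, ‖f‖ ≤ 1 ∧ t = |f x|} ‖x‖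

/-- The slice `S(f, ε) = {x ∈ B_X : f x > 1 - ε}` of the closed unit ball of `X`. -/
def ballSlice {X : Type*} [NormedAddCommGroup X] [NormedSpace ℝ X]
    (f : StrongDual ℝ X) (ε : ℝ) : Set X :=
  {x | ‖x‖ ≤ 1 ∧ 1 - ε < f x}

/-- The set `∑ i, c i • S i = {∑ i, c i • s i : s i ∈ S i}`. -/
def setCombination {X : Type*} [NormedAddCommGroup X] [NormedSpace ℝ X]
    {n : ℕ} (c : Fin n → ℝ) (S : Fin n → Set X) : Set X :=
  {x | ∃ s : Fin n → X, (∀ i, s i ∈ S i) ∧ x = ∑ i, c i • s i}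

/-- The strong diameter 2 property: every finite convex combination of slices of the unit ball
has diameter 2. -/
def StrongDiameterTwo (X : Type*) [NormedAddCommGroup X] [NormedSpace ℝ X] : Prop :=
  ∀ (n : ℕ) (c : Fin n → ℝ) (f : Fin n → StrongDual ℝ X) (ε : Fin n → ℝ),
    (∀ i, 0 ≤ c i) → ∑ i, c i = 1 → (∀ i, ‖f i‖ = 1) → (∀ i, 0 < ε i) →
    Metric.diam (setCombination c fun i => ballSlice (f i) (ε i)) = 2

/-! The proof works with finite systems of norm conditions, each solved by duality: a Helly-type
lemma (`exists_forall_norm_add_lt`, a consequence of Hahn–Banach) reduces the solvability of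
`‖p j + L j v‖ < r`, `|t k + g k v| < δ` to an inequality between functionals.

Let `X* = Z ⊕₁ Y^⊥`. Restriction to `Y` identifies `Z` with `Y*` isometrically. Two instances of
the Helly-type lemma carry the argument.

* Ball intersection (`IsLSum.exists_ball_intersection`): if the `y j ∈ Y` and `x ∈ X` have norm at
  most `M`, there is `z ∈ Y` with all `‖y j + (x - z)‖` almost at most `M` and with `x - z` almost
  annihilated by finitely many given elements of `Z`.
* Reflection into `Y` (`IsLSum.exists_mem_approx`): elements of `X` act on `Z ≅ Y*`, so, as in the
  principle of local reflexivity, `w ∈ X` can be replaced by some `u ∈ Y` that almost preserves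
  the bounds `‖y j + e j • w‖ ≤ M` and the values of finitely many elements of `Z`.

By the Riesz lemma there is a unit vector `x` almost at distance one from `Y`. Ball intersection
turns it into `w = x - z`, of norm almost one or more, with `‖y i ± w‖` almost at most one and with
`w` almost annihilated by the functionals defining given slices of `B_Y`, where `y i` lies in the
`i`-th slice. As `Z` is 1-norming, the norm of `w` is witnessed by an element of `Z`, so that `w`
may be replaced by `u ∈ Y`. Then the points `y i ± u` lie almost in the slices, and the convex
combinations of the `y i + u` and of the `y i - u` differ by `2 u`. This settles `Y`.

For `X`, split `f i = g i + h i` along `Z ⊕₁ Y^⊥`. Apply the case of `Y` to the restrictions of the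
`g i` to get points `y i, y' i ∈ Y`, and choose `x i` in the unit ball of `X` with `h i (x i)` almost
`‖h i‖`. Ball intersection gives `z i ∈ Y` such that `y i + (x i - z i)` and `y' i + (x i - z i)` lie
almost in the slice of `f i`; the differences `y i - y' i` are unchanged.

If `X` is M-embedded with `X*** = Z ⊕₁ X^⊥`, then `Z` contains the canonical image of `X*`, because
the `Z`-component of such a functional has the same restriction to `X` and hence no smaller norm.
So `Z` is 1-norming for `X**`, and the first part applies to `X ⊆ X**`. -/

/-! ### A Helly-type lemma -/

lemma exists_norm_lt_one_lt_apply {E : Type*} [NormedAddCommGroup E] [NormedSpace ℝ E]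
    (φ : StrongDual ℝ E) {s : ℝ} (hs : s < ‖φ‖) : ∃ x, ‖x‖ < 1 ∧ s < φ x := by
  obtain ⟨x, hx, hlt⟩ := φ.exists_lt_apply_of_lt_opNorm hs
  rw [Real.norm_eq_abs] at hlt
  rcases lt_abs.mp hlt with h | h
  · exact ⟨x, hx, h⟩
  · exact ⟨-x, by simpa using hx, by simpa using h⟩

/-- The distance of `p` from a subspace is at most `M` if every functional `φ` vanishing on that
subspace satisfies `φ p ≤ M * ‖φ‖`. -/
lemma exists_norm_add_lt {V E : Type*} [AddCommGroup V] [Module ℝ V] [NormedAddCommGroup E]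
    [NormedSpace ℝ E] (L : V →ₗ[ℝ] E) (p : E) {M r : ℝ} (hM : 0 ≤ M) (hr : M < r)
    (h : ∀ φ : StrongDual ℝ E, (∀ v, φ (L v) = 0) → φ p ≤ M * ‖φ‖) :
    ∃ v, ‖p + L v‖ < r := by
  by_contra! hcon
  have hr0 : 0 < r := hM.trans_lt hr
  have hdisj : Disjoint (Metric.ball p r) (LinearMap.range L : Set E) := by
    rw [Set.disjoint_left]
    rintro _ hx ⟨v, rfl⟩
    have h1 := hcon (-v)
    rw [Metric.mem_ball, dist_comm, dist_eq_norm] at hx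
    rw [map_neg, ← sub_eq_add_neg] at h1
    linarith
  obtain ⟨φ, c, hlt, hge⟩ := geometric_hahn_banach_open (convex_ball p r) Metric.isOpen_ball
    (LinearMap.range L).convex hdisj
  -- A linear functional bounded below on a subspace vanishes there.
  have hzero : ∀ v, φ (L v) = 0 := by
    intro v
    by_contra hne
    have h1 := hge (L (((c - 1) / φ (L v)) • v)) ⟨_, rfl⟩
    rw [map_smul, map_smul, smul_eq_mul, div_mul_cancel₀ _ hne] at h1
    linarith
  have hc : c ≤ 0 := by simpa using hge 0 (Submodule.zero_mem _)
  have hp : φ p < 0 := (hlt p (Metric.mem_ball_self hr0)).trans_le hc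
  have hφp : -φ p ≤ M * ‖φ‖ := by
    simpa using h (-φ) (fun v => by simp [hzero v])
  have hφ : 0 < ‖φ‖ := by
    rw [norm_pos_iff]
    rintro rfl
    simp at hp
  -- A point of the ball around `p` at which `φ` is too large.
  obtain ⟨x, hx, hlt'⟩ := exists_norm_lt_one_lt_apply φ (s := M / r * ‖φ‖) (by
    have : M / r < 1 := (div_lt_one hr0).mpr hr
    nlinarith)
  have h1 := hlt (p + r • x) (by
    rw [Metric.mem_ball, dist_eq_norm, add_sub_cancel_left, norm_smul, Real.norm_eq_abs,
      abs_of_pos hr0]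
    nlinarith)
  rw [map_add, map_smul, smul_eq_mul] at h1
  have h2 : r * (M / r * ‖φ‖) < r * φ x := mul_lt_mul_of_pos_left hlt' hr0
  have h3 : r * (M / r * ‖φ‖) = M * ‖φ‖ := by field_simp
  linarith

/-- A functional on a finite `ℓ_∞`-sum has at least the `ℓ_1`-norm of its components. -/
lemma sum_norm_comp_single_le {J E : Type*} [Fintype J] [DecidableEq J] [NormedAddCommGroup E]
    [NormedSpace ℝ E] (φ : StrongDual ℝ (J → E)) :
    ∑ j, ‖φ.comp (ContinuousLinearMap.single ℝ (fun _ : J => E) j)‖ ≤ ‖φ‖ := by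
  refine le_of_forall_pos_le_add fun ε hε => ?_
  have hη : 0 < ε / (Fintype.card J + 1) := by positivity
  choose x hx hlt using fun j => exists_norm_lt_one_lt_apply
    (φ.comp (ContinuousLinearMap.single ℝ (fun _ : J => E) j)) (sub_lt_self _ hη)
  have hnorm : ‖x‖ ≤ 1 := (pi_norm_le_iff_of_nonneg zero_le_one).mpr fun j => (hx j).le
  have hφx : φ x ≤ ‖φ‖ := (le_abs_self _).trans (φ.unit_le_opNorm x hnorm)
  have hsum : ∑ j, φ (Pi.single j (x j)) = φ x := by
    rw [← map_sum, LinearMap.sum_single_apply]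
  have hle : ∑ j, (‖φ.comp (ContinuousLinearMap.single ℝ (fun _ : J => E) j)‖
      - ε / (Fintype.card J + 1)) ≤ ∑ j, φ (Pi.single j (x j)) :=
    Finset.sum_le_sum fun j _ => (hlt j).le
  rw [Finset.sum_sub_distrib, Finset.sum_const, Finset.card_univ, nsmul_eq_mul] at hle
  have hcard : (Fintype.card J : ℝ) * (ε / (Fintype.card J + 1)) ≤ ε := by
    rw [mul_div_assoc', div_le_iff₀ (by positivity)]
    nlinarith
  linarith

/-- A Helly-type lemma: the system `‖p j + L j v‖ < r`, `|t k + g k v| < δ` can be solved for `v` as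
soon as every linear combination of the data that does not depend on `v` is suitably bounded. -/
lemma exists_forall_norm_add_lt {V E J K : Type*} [AddCommGroup V] [Module ℝ V]
    [NormedAddCommGroup E] [NormedSpace ℝ E] [Fintype J] [Fintype K]
    (L : J → V →ₗ[ℝ] E) (g : K → V →ₗ[ℝ] ℝ) (p : J → E) (t : K → ℝ) {M r δ : ℝ} (hM : 0 ≤ M)
    (hr : M < r) (hδ : 0 < δ)
    (h : ∀ (φ : J → StrongDual ℝ E) (s : K → ℝ),
      (∀ v, ∑ j, φ j (L j v) + ∑ k, s k * g k v = 0) →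
      ∑ j, φ j (p j) + ∑ k, s k * t k ≤ M * ∑ j, ‖φ j‖) :
    ∃ v, (∀ j, ‖p j + L j v‖ < r) ∧ ∀ k, |t k + g k v| < δ := by
  classical
  have hr0 : 0 < r := hM.trans_lt hr
  -- The scalar conditions are rescaled so that both kinds have the same bound `r`.
  let G : V →ₗ[ℝ] (J → E) × (K → ℝ) :=
    (LinearMap.pi L).prod (LinearMap.pi fun k => (r / δ) • g k)
  obtain ⟨v, hv⟩ := exists_norm_add_lt G (p, fun k => r / δ * t k) hM hr (by
    intro φ hφ
    have hdecomp : ∀ (a : J → E) (b : K → ℝ), φ (a, b) =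
        ∑ j, φ (Pi.single j (a j), 0) + ∑ k, φ (0, Pi.single k 1) * b k := by
      intro a b
      have ha : φ (a, 0) = ∑ j, φ (Pi.single j (a j), 0) := by
        have := map_sum (φ.comp (ContinuousLinearMap.inl ℝ (J → E) (K → ℝ)))
          (fun j => Pi.single j (a j)) Finset.univ
        rw [LinearMap.sum_single_apply] at this
        simpa using this
      have hb : φ (0, b) = ∑ k, φ (0, Pi.single k 1) * b k := by
        have := map_sum (φ.comp (ContinuousLinearMap.inr ℝ (J → E) (K → ℝ)))
          (fun k => b k • Pi.single k (1 : ℝ)) Finset.univ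
        rw [← pi_eq_sum_univ' b] at this
        simpa [mul_comm] using this
      rw [← ha, ← hb, ← map_add]
      simp
    let φJ : StrongDual ℝ (J → E) := φ.comp (ContinuousLinearMap.inl ℝ (J → E) (K → ℝ))
    have hφJ : ‖φJ‖ ≤ ‖φ‖ := by
      refine φJ.opNorm_le_bound (norm_nonneg _) fun a => ?_
      have := φ.le_opNorm (a, 0)
      simpa [φJ, Prod.norm_def] using this
    have key := h (fun j => φJ.comp (ContinuousLinearMap.single ℝ (fun _ : J => E) j))
      (fun k => φ (0, Pi.single k 1) * (r / δ)) (by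
        intro v
        rw [← hφ v]
        refine Eq.trans ?_ (hdecomp _ _).symm
        simp [φJ, mul_assoc])
    rw [hdecomp]
    refine le_trans (le_of_eq ?_) (key.trans ?_)
    · simp [φJ, mul_assoc]
    · gcongr
      exact (sum_norm_comp_single_le φJ).trans hφJ)
  refine ⟨v, fun j => ?_, fun k => ?_⟩
  · exact (norm_le_pi_norm ((p, fun k => r / δ * t k) + G v).1 j).trans_lt
      ((norm_fst_le _).trans_lt hv)
  · have h1 : ‖((p, fun k => r / δ * t k) + G v).2 k‖ < r :=
      (norm_le_pi_norm ((p, fun k => r / δ * t k) + G v).2 k).trans_lt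
        ((norm_snd_le _).trans_lt hv)
    have h2 : ((p, fun k => r / δ * t k) + G v).2 k = r / δ * (t k + g k v) := by
      simp [G, mul_add]
    rw [h2, norm_mul, Real.norm_eq_abs, Real.norm_eq_abs, abs_of_pos (div_pos hr0 hδ),
      div_mul_eq_mul_div, div_lt_iff₀ hδ] at h1
    exact lt_of_mul_lt_mul_left h1 hr0.le

/-! ### M-ideals -/

section MIdeal

variable {X : Type*} [NormedAddCommGroup X] [NormedSpace ℝ X] {Y : Submodule ℝ X}
  {Z : Submodule ℝ (StrongDual ℝ X)}

lemma IsLSum.exists_add_eq {E : Type*} [NormedAddCommGroup E] [NormedSpace ℝ E]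
    {Z W : Submodule ℝ E} (h : IsLSum Z W) (f : E) :
    ∃ z ∈ Z, ∃ w ∈ W, z + w = f ∧ ‖f‖ = ‖z‖ + ‖w‖ := by
  obtain ⟨z, hz, w, hw, rfl⟩ :=
    Submodule.mem_sup.mp (h.1.sup_eq_top ▸ Submodule.mem_top : f ∈ Z ⊔ W)
  exact ⟨z, hz, w, hw, rfl, h.2 z hz w hw⟩

/-- Every functional on `Y` has a norm-preserving extension in `Z`: take the `Z`-component of a
Hahn–Banach extension. -/
lemma IsLSum.exists_extension (h : IsLSum Z (topAnnihilator Y)) (f : StrongDual ℝ Y) :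
    ∃ g ∈ Z, (∀ y : Y, g y = f y) ∧ ‖g‖ ≤ ‖f‖ := by
  obtain ⟨G, hG, hGn⟩ := exists_extension_norm_eq Y f
  obtain ⟨z, hz, w, hw, rfl, hn⟩ := h.exists_add_eq G
  refine ⟨z, hz, fun y => ?_, ?_⟩
  · rw [← hG y, add_apply, hw y y.2, add_zero]
  · rw [← hGn, hn]
    exact le_add_of_nonneg_right (norm_nonneg w)

lemma IsLSum.eq_of_eqOn (h : IsLSum Z (topAnnihilator Y)) {f g : StrongDual ℝ X} (hf : f ∈ Z)
    (hg : g ∈ Z) (hfg : ∀ y ∈ Y, f y = g y) : f = g := by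
  have hmem : f - g ∈ topAnnihilator Y := fun y hy => by simp [hfg y hy]
  exact sub_eq_zero.mp (Submodule.disjoint_def.mp h.1.disjoint _ (Z.sub_mem hf hg) hmem)

lemma IsLSum.norm_le_norm_comp_subtypeL (h : IsLSum Z (topAnnihilator Y)) {g : StrongDual ℝ X}
    (hg : g ∈ Z) : ‖g‖ ≤ ‖g.comp Y.subtypeL‖ := by
  obtain ⟨G, hG, hGr, hGn⟩ := h.exists_extension (g.comp Y.subtypeL)
  have hGg : G = g := h.eq_of_eqOn hG hg fun y hy => hGr ⟨y, hy⟩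
  rwa [hGg] at hGn

/-- The ball intersection property of M-ideals, with additional control of finitely many elements
of `Z`. -/
lemma IsLSum.exists_ball_intersection (h : IsLSum Z (topAnnihilator Y)) {J K : Type*} [Fintype J]
    [Fintype K] (y : J → X) (hyY : ∀ j, y j ∈ Y) (x : X) (g : K → StrongDual ℝ X)
    (hg : ∀ k, g k ∈ Z) {M r δ : ℝ} (hy : ∀ j, ‖y j‖ ≤ M) (hx : ‖x‖ ≤ M) (hr : M < r)
    (hδ : 0 < δ) :
    ∃ z ∈ Y, (∀ j, ‖y j + (x - z)‖ < r) ∧ ∀ k, |g k (x - z)| < δ := by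
  have hM : 0 ≤ M := (norm_nonneg x).trans hx
  obtain ⟨v, hv, hv'⟩ := exists_forall_norm_add_lt (V := Y) (fun _ : J => -Y.subtype)
    (fun k => -((g k).toLinearMap ∘ₗ Y.subtype)) (fun j => y j + x) (fun k => g k x) hM hr hδ (by
      intro φ s hφ
      choose a ha b hb hab hn using fun j => h.exists_add_eq (φ j)
      -- The `Z`-component of the combination vanishes, as it vanishes on `Y`.
      have hzero : ∑ j, a j + ∑ k, s k • g k = 0 := by
        refine h.eq_of_eqOn (Z.add_mem (Z.sum_mem fun j _ => ha j)
          (Z.sum_mem fun k _ => Z.smul_mem _ (hg k))) Z.zero_mem fun u hu => ?_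
        have h1 := hφ ⟨u, hu⟩
        have h2 : ∀ j, φ j u = a j u := fun j => by
          rw [← hab j, add_apply, hb j u hu, add_zero]
        simp only [LinearMap.neg_apply, Submodule.subtype_apply, map_neg, h2,
          LinearMap.comp_apply, ContinuousLinearMap.coe_coe, mul_neg,
          Finset.sum_neg_distrib] at h1
        simp only [add_apply, sum_apply,
          smul_apply, smul_eq_mul, zero_apply]
        linarith
      have hx0 := DFunLike.congr_fun hzero x
      simp only [add_apply, sum_apply,
        smul_apply, smul_eq_mul, zero_apply] at hx0
      have hsplit : ∑ j, φ j (y j + x) = ∑ j, (a j (y j) + b j x) + ∑ j, a j x := by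
        rw [← Finset.sum_add_distrib]
        refine Finset.sum_congr rfl fun j _ => ?_
        rw [← hab j, add_apply, map_add, map_add, hb j _ (hyY j)]
        ring
      have hle : ∑ j, (a j (y j) + b j x) ≤ M * ∑ j, ‖φ j‖ := by
        rw [Finset.mul_sum]
        refine Finset.sum_le_sum fun j _ => ?_
        have h1 := (le_abs_self _).trans ((a j).le_of_opNorm_le_of_le le_rfl (hy j))
        have h2 := (le_abs_self _).trans ((b j).le_of_opNorm_le_of_le le_rfl hx)
        rw [hn j]
        linarith
      rw [hsplit]
      linarith)
  refine ⟨v, v.2, fun j => ?_, fun k => ?_⟩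
  · simpa [sub_eq_add_neg, add_assoc] using hv j
  · simpa [sub_eq_add_neg] using hv' k

/-- Local reflexivity for the action of `X` on `Z ≅ Y*`: an element `w` of `X` may be replaced by
some `u ∈ Y`, almost preserving finitely many norm bounds and values of elements of `Z`. -/
lemma IsLSum.exists_mem_approx (h : IsLSum Z (topAnnihilator Y)) {J K : Type*} [Fintype J]
    [Fintype K] (y : J → Y) (e : J → ℝ) (w : X) (g : K → StrongDual ℝ X)
    (hg : ∀ k, g k ∈ Z) {M r δ : ℝ} (hM : 0 ≤ M) (hy : ∀ j, ‖(y j : X) + e j • w‖ ≤ M) (hr : M < r)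
    (hδ : 0 < δ) :
    ∃ u : Y, (∀ j, ‖y j + e j • u‖ < r) ∧ ∀ k, |g k u - g k w| < δ := by
  obtain ⟨u, hu, hu'⟩ := exists_forall_norm_add_lt (V := Y) (fun j => e j • LinearMap.id)
    (fun k => (g k).toLinearMap ∘ₗ Y.subtype) y (fun k => -g k w) hM hr hδ (by
      intro φ s hφ
      choose a ha har han using fun j => h.exists_extension (φ j)
      have hzero : ∑ j, e j • a j + ∑ k, s k • g k = 0 := by
        refine h.eq_of_eqOn (Z.add_mem (Z.sum_mem fun j _ => Z.smul_mem _ (ha j))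
          (Z.sum_mem fun k _ => Z.smul_mem _ (hg k))) Z.zero_mem fun u hu => ?_
        have h1 := hφ ⟨u, hu⟩
        have h2 : ∀ j, φ j ⟨u, hu⟩ = a j u := fun j => (har j ⟨u, hu⟩).symm
        have h3 : ∀ j, φ j (e j • ⟨u, hu⟩) = e j * a j u := fun j => by
          rw [map_smul, smul_eq_mul, h2]
        simpa only [LinearMap.smul_apply, LinearMap.id_apply, h3, LinearMap.comp_apply,
          Submodule.subtype_apply, ContinuousLinearMap.coe_coe, add_apply, sum_apply, smul_apply,
          smul_eq_mul, zero_apply] using h1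
      have hw0 := DFunLike.congr_fun hzero w
      simp only [add_apply, sum_apply,
        smul_apply, smul_eq_mul, zero_apply] at hw0
      have hsplit : ∑ j, a j (y j + e j • w) = ∑ j, φ j (y j) + ∑ j, e j * a j w := by
        rw [← Finset.sum_add_distrib]
        refine Finset.sum_congr rfl fun j _ => ?_
        rw [map_add, map_smul, har j, smul_eq_mul]
      have hle : ∑ j, a j (y j + e j • w) ≤ M * ∑ j, ‖φ j‖ := by
        rw [Finset.mul_sum]
        refine Finset.sum_le_sum fun j _ => ?_
        rw [mul_comm]
        exact (le_abs_self _).trans ((a j).le_of_opNorm_le_of_le (han j) (hy j))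
      simp only [mul_neg, Finset.sum_neg_distrib]
      linarith)
  refine ⟨u, fun j => ?_, fun k => ?_⟩
  · simpa using hu j
  · have := hu' k
    rw [neg_add_eq_sub] at this
    exact this

end MIdeal

/-! ### The strong diameter 2 property -/

/-- An approximate form of the strong diameter 2 property. The points are in a slightly enlarged
ball, and the functionals are not normalised (and possibly zero). -/
def ApproxStrongDiameterTwo (X : Type*) [NormedAddCommGroup X] [NormedSpace ℝ X] : Prop :=
  ∀ (n : ℕ) (c : Fin n → ℝ) (f : Fin n → StrongDual ℝ X) (δ : ℝ),
    (∀ i, 0 ≤ c i) → ∑ i, c i = 1 → 0 < δ →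
    ∃ x x' : Fin n → X, (∀ i, ‖x i‖ ≤ 1 + δ) ∧ (∀ i, ‖x' i‖ ≤ 1 + δ) ∧
      (∀ i, ‖f i‖ - δ < f i (x i)) ∧ (∀ i, ‖f i‖ - δ < f i (x' i)) ∧
      2 - δ < ‖∑ i, c i • (x i - x' i)‖

lemma norm_le_one_of_mem_setCombination {X : Type*} [NormedAddCommGroup X] [NormedSpace ℝ X]
    {n : ℕ} {c : Fin n → ℝ} {f : Fin n → StrongDual ℝ X} {ε : Fin n → ℝ} (hc : ∀ i, 0 ≤ c i)
    (hc1 : ∑ i, c i = 1) {x : X} (hx : x ∈ setCombination c fun i => ballSlice (f i) (ε i)) :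
    ‖x‖ ≤ 1 := by
  obtain ⟨s, hs, rfl⟩ := hx
  calc ‖∑ i, c i • s i‖ ≤ ∑ i, c i := norm_sum_le_of_le _ fun i _ => by
        rw [norm_smul, Real.norm_eq_abs, abs_of_nonneg (hc i)]
        exact mul_le_of_le_one_right (hc i) (hs i).1
    _ = 1 := hc1

lemma ApproxStrongDiameterTwo.strongDiameterTwo {X : Type*} [NormedAddCommGroup X]
    [NormedSpace ℝ X] (h : ApproxStrongDiameterTwo X) : StrongDiameterTwo X := by
  intro n c f ε hc hc1 hf hε
  set S := setCombination c fun i => ballSlice (f i) (ε i)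
  have hball : ∀ x ∈ S, ‖x‖ ≤ 1 := fun x hx => norm_le_one_of_mem_setCombination hc hc1 hx
  have hdist : ∀ x ∈ S, ∀ y ∈ S, dist x y ≤ 2 := fun x hx y hy => by
    rw [dist_eq_norm]
    linarith [norm_sub_le x y, hball x hx, hball y hy]
  refine le_antisymm (Metric.diam_le_of_forall_dist_le zero_le_two hdist) ?_
  have hbdd : Bornology.IsBounded S := Metric.isBounded_iff.mpr ⟨2, fun x hx y hy => hdist x hx y hy⟩
  refine le_of_forall_pos_le_add fun η hη => ?_
  obtain ⟨δ, hδ, hδη, hδε⟩ : ∃ δ > 0, 3 * δ ≤ η ∧ ∀ i, 2 * δ ≤ ε i := by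
    have hη3 : 0 < η / 3 := by positivity
    obtain ⟨ε₀, hε₀, hle⟩ : ∃ ε₀ > 0, ∀ i, ε₀ ≤ ε i := by
      rcases isEmpty_or_nonempty (Fin n) with hn | hn
      · exact ⟨1, one_pos, fun i => hn.elim i⟩
      · obtain ⟨i₀, hi₀⟩ := Finite.exists_min ε
        exact ⟨ε i₀, hε i₀, hi₀⟩
    refine ⟨min (η / 3) (ε₀ / 2), lt_min hη3 (by positivity), ?_, fun i => ?_⟩
    · linarith [min_le_left (η / 3) (ε₀ / 2)]
    · linarith [min_le_right (η / 3) (ε₀ / 2), hle i]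
  obtain ⟨x, x', hx, hx', hfx, hfx', hxx'⟩ := h n c f δ hc hc1 hδ
  have hδ1 : 0 < 1 + δ := by linarith
  -- Scaling by `(1 + δ)⁻¹` moves the points into the slices.
  have hslice : ∀ i (v : X), ‖v‖ ≤ 1 + δ → ‖f i‖ - δ < f i v →
      (1 + δ)⁻¹ • v ∈ ballSlice (f i) (ε i) := by
    intro i v hv hfv
    constructor
    · rw [norm_smul, norm_inv, Real.norm_eq_abs, abs_of_pos hδ1, inv_mul_le_iff₀ hδ1]
      linarith
    · rw [map_smul, smul_eq_mul, lt_inv_mul_iff₀ hδ1]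
      rw [hf i] at hfv
      nlinarith [hδε i]
  have hmem := Metric.dist_le_diam_of_mem hbdd
    (⟨fun i => (1 + δ)⁻¹ • x i, fun i => hslice i _ (hx i) (hfx i), rfl⟩ :
      ∑ i, c i • (1 + δ)⁻¹ • x i ∈ S)
    (⟨fun i => (1 + δ)⁻¹ • x' i, fun i => hslice i _ (hx' i) (hfx' i), rfl⟩ :
      ∑ i, c i • (1 + δ)⁻¹ • x' i ∈ S)
  have heq : ∑ i, c i • (1 + δ)⁻¹ • x i - ∑ i, c i • (1 + δ)⁻¹ • x' i
      = (1 + δ)⁻¹ • ∑ i, c i • (x i - x' i) := by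
    rw [← Finset.sum_sub_distrib, Finset.smul_sum]
    refine Finset.sum_congr rfl fun i _ => ?_
    rw [smul_comm (c i), smul_comm (c i), ← smul_sub, ← smul_sub]
  rw [dist_eq_norm, heq, norm_smul, norm_inv, Real.norm_eq_abs, abs_of_pos hδ1,
    inv_mul_le_iff₀ hδ1] at hmem
  by_contra! hcon
  nlinarith

lemma StrongDiameterTwo.of_linearIsometryEquiv {X X' : Type*} [NormedAddCommGroup X]
    [NormedSpace ℝ X] [NormedAddCommGroup X'] [NormedSpace ℝ X'] (e : X ≃ₗᵢ[ℝ] X')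
    (h : StrongDiameterTwo X) : StrongDiameterTwo X' := by
  intro n c f ε hc hc1 hf hε
  let g : Fin n → StrongDual ℝ X := fun i => (f i).comp e.toContinuousLinearEquiv.toContinuousLinearMap
  have hg : ∀ i, ‖g i‖ = 1 := fun i => by
    rw [← hf i]
    exact (f i).opNorm_comp_linearIsometryEquiv e
  rw [← h n c g ε hc hc1 hg hε, ← e.isometry.diam_image]
  congr 1
  ext v
  constructor
  · rintro ⟨s, hs, rfl⟩
    refine ⟨∑ i, c i • e.symm (s i), ⟨fun i => e.symm (s i), fun i => ⟨?_, ?_⟩, rfl⟩, ?_⟩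
    · simpa using (hs i).1
    · simpa [g] using (hs i).2
    · simp
  · rintro ⟨_, ⟨s, hs, rfl⟩, rfl⟩
    refine ⟨fun i => e (s i), fun i => ⟨?_, ?_⟩, ?_⟩
    · simpa using (hs i).1
    · simpa [g] using (hs i).2
    · simp

lemma StrongDiameterTwo.of_range {X W : Type*} [NormedAddCommGroup X] [NormedSpace ℝ X]
    [NormedAddCommGroup W] [NormedSpace ℝ W] (J : X →ₗᵢ[ℝ] W)
    {Y : Submodule ℝ W} (hY : ∀ w, w ∈ Y ↔ ∃ x, J x = w) (h : StrongDiameterTwo Y) :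
    StrongDiameterTwo X := by
  obtain rfl : Y = LinearMap.range J.toLinearMap := Submodule.ext hY
  exact h.of_linearIsometryEquiv J.equivRange.symm

/-! ### Proper M-ideals with a 1-norming complement -/

section ProperMIdeal

variable {X : Type*} [NormedAddCommGroup X] [NormedSpace ℝ X] {Y : Submodule ℝ X}
  {Z : Submodule ℝ (StrongDual ℝ X)}

lemma IsOneNorming.exists_lt_apply (hZ : IsOneNorming Z) (x : X) {s : ℝ} (hs : s < ‖x‖) :
    ∃ g ∈ Z, ‖g‖ ≤ 1 ∧ s < g x := by
  obtain ⟨_, ⟨f, hf, hfn, rfl⟩, hlt, -⟩ := (hZ x).exists_between hs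
  rcases lt_abs.mp hlt with h | h
  · exact ⟨f, hf, hfn, h⟩
  · exact ⟨-f, Z.neg_mem hf, by rwa [norm_neg], h⟩

lemma IsLSum.approxStrongDiameterTwo_subspace (h : IsLSum Z (topAnnihilator Y))
    (hY : IsClosed (Y : Set X)) (hYtop : Y ≠ ⊤) (hZ : IsOneNorming Z) :
    ApproxStrongDiameterTwo Y := by
  intro n c f δ hc hc1 hδ
  obtain ⟨η, hη, rfl⟩ : ∃ η > 0, δ = 8 * η := ⟨δ / 8, by positivity, by ring⟩
  choose g hgZ hgf hgn using fun i => h.exists_extension (f i)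
  choose y hy hfy using fun i => exists_norm_lt_one_lt_apply (f i) (sub_lt_self _ hη)
  -- A unit vector almost at distance one from `Y`.
  obtain ⟨x, hx, hxY⟩ : ∃ x : X, ‖x‖ = 1 ∧ ∀ z ∈ Y, 1 - η ≤ ‖x - z‖ := by
    have hex : ∃ x, x ∉ Y := by
      by_contra! hall
      exact hYtop (Submodule.eq_top_iff'.mpr hall)
    obtain ⟨x₀, hx₀, hd⟩ := riesz_lemma hY hex (sub_lt_self 1 hη)
    have hpos : 0 < ‖x₀‖ := by
      rw [norm_pos_iff]
      rintro rfl
      exact hx₀ Y.zero_mem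
    refine ⟨‖x₀‖⁻¹ • x₀, norm_smul_inv_norm (𝕜 := ℝ) (norm_pos_iff.mp hpos), fun z hz => ?_⟩
    have h1 := hd (‖x₀‖ • z) (Y.smul_mem _ hz)
    have h2 : ‖x₀‖⁻¹ • x₀ - z = ‖x₀‖⁻¹ • (x₀ - ‖x₀‖ • z) := by
      rw [smul_sub, inv_smul_smul₀ hpos.ne']
    rw [h2, norm_smul, norm_inv, norm_norm, le_inv_mul_iff₀ hpos, mul_comm]
    exact h1
  obtain ⟨z, hz, hzn, hzg⟩ := h.exists_ball_intersection (M := 1) (r := 1 + η)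
    (Sum.elim (fun i => (y i : X)) (fun i => -(y i : X)))
    (by rintro (i | i) <;> simp) x g hgZ
    (by rintro (i | i) <;> simpa using (hy i).le) hx.le (by linarith) hη
  set w := x - z with hw
  have hwn : 1 - η ≤ ‖w‖ := hxY z hz
  obtain ⟨g₀, hg₀Z, hg₀n, hg₀⟩ := hZ.exists_lt_apply w (sub_lt_self ‖w‖ hη)
  obtain ⟨u, hun, hug⟩ := h.exists_mem_approx (M := 1 + η) (r := 1 + 2 * η)
    (Sum.elim y y) (Sum.elim (fun _ => 1) (fun _ => -1)) w
    (Option.elim · g₀ g) (by rintro (_ | k); exacts [hg₀Z, hgZ k]) (by linarith)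
    (by
      rintro (i | i)
      · simpa using (hzn (Sum.inl i)).le
      · have := (hzn (Sum.inr i)).le
        rw [← norm_neg]
        simpa [add_comm] using this) (by linarith) hη
  have hu : 1 - 3 * η < ‖u‖ := by
    have h1 := (abs_lt.mp (hug none)).1
    have h2 : g₀ u ≤ ‖u‖ := by
      have := (le_abs_self _).trans (g₀.le_of_opNorm_le hg₀n (u : X))
      simpa using this
    simp only [Option.elim] at h1
    linarith
  have hfu : ∀ i, |f i u| < 2 * η := fun i => by
    have h1 := abs_lt.mp (hug (some i))
    have h2 := abs_lt.mp (hzg i)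
    simp only [Option.elim] at h1
    rw [← hgf i, abs_lt]
    constructor <;> linarith
  refine ⟨fun i => y i + u, fun i => y i - u, fun i => ?_, fun i => ?_, fun i => ?_, fun i => ?_, ?_⟩
  · have := hun (Sum.inl i)
    simp only [Sum.elim_inl, one_smul] at this
    linarith
  · have := hun (Sum.inr i)
    simp only [Sum.elim_inr, neg_smul, one_smul, ← sub_eq_add_neg] at this
    linarith
  · rw [map_add]
    linarith [hfy i, (abs_lt.mp (hfu i)).1]
  · rw [map_sub]
    linarith [hfy i, (abs_lt.mp (hfu i)).2]
  · have heq : ∑ i, c i • (y i + u - (y i - u)) = (2 : ℝ) • u := by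
      have : ∀ i, y i + u - (y i - u) = (2 : ℝ) • u := fun i => by
        rw [two_smul]
        abel
      simp only [this]
      rw [← Finset.sum_smul, hc1, one_smul]
    rw [heq, norm_smul, Real.norm_ofNat]
    linarith

/-- The approximate strong diameter 2 property passes from an M-ideal to the whole space. -/
lemma IsLSum.approxStrongDiameterTwo (h : IsLSum Z (topAnnihilator Y))
    (hYd : ApproxStrongDiameterTwo Y) : ApproxStrongDiameterTwo X := by
  intro n c f δ hc hc1 hδ
  obtain ⟨η, hη, rfl⟩ : ∃ η > 0, δ = 3 * η := ⟨δ / 3, by positivity, by ring⟩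
  choose g hg k hk hgk hn using fun i => h.exists_add_eq (f i)
  obtain ⟨y, y', hy, hy', hgy, hgy', hd⟩ :=
    hYd n c (fun i => (g i).comp Y.subtypeL) η hc hc1 hη
  choose x hx hkx using fun i => exists_norm_lt_one_lt_apply (k i) (sub_lt_self _ hη)
  choose z hz hzn hzg using fun i => h.exists_ball_intersection (M := 1 + η) (r := 1 + 2 * η)
    (fun b : Bool => ((bif b then y i else y' i : Y) : X)) (fun b => Subtype.property _) (x i)
    (fun _ : Unit => g i) (fun _ => hg i) (by rintro (_ | _); exacts [hy' i, hy i])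
    (by linarith [hx i]) (by linarith) hη
  have hval : ∀ i (v : Y), ‖(g i).comp Y.subtypeL‖ - η < g i v →
      ‖f i‖ - 3 * η < f i (v + (x i - z i)) := by
    intro i v hv
    have h1 := (abs_lt.mp (hzg i ())).1
    have h2 := h.norm_le_norm_comp_subtypeL (hg i)
    have h3 : f i (v + (x i - z i)) = g i v + g i (x i - z i) + k i (x i) := by
      rw [← hgk i, add_apply, map_add, map_add (k i), map_sub (k i),
        hk i v v.2, hk i (z i) (hz i)]
      ring
    rw [h3, hn i]
    linarith [hkx i]
  refine ⟨fun i => y i + (x i - z i), fun i => y' i + (x i - z i), fun i => ?_, fun i => ?_,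
    fun i => hval i _ (hgy i), fun i => hval i _ (hgy' i), ?_⟩
  · have := hzn i true
    simp only [cond_true] at this
    linarith
  · have := hzn i false
    simp only [cond_false] at this
    linarith
  · have heq : ∑ i, c i • ((y i : X) + (x i - z i) - (y' i + (x i - z i)))
        = ((∑ i, c i • (y i - y' i) : Y) : X) := by
      simp
    rw [heq, ← Submodule.coe_norm]
    linarith

end ProperMIdeal

/-! ### M-embedded spaces -/

/-- If `X*** = Z ⊕₁ X^⊥`, then `Z` contains the canonical image of `X*`. -/
lemma IsLSum.inclusionInDoubleDual_mem {X : Type*} [NormedAddCommGroup X] [NormedSpace ℝ X]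
    {Z : Submodule ℝ (StrongDual ℝ (StrongDual ℝ (StrongDual ℝ X)))}
    (h : IsLSum Z (topAnnihilator (X := StrongDual ℝ (StrongDual ℝ X)) (canonicalImage X))) (f : StrongDual ℝ X) :
    NormedSpace.inclusionInDoubleDual ℝ (StrongDual ℝ X) f ∈ Z := by
  obtain ⟨z, hz, w, hw, hzw, hn⟩ :=
    h.exists_add_eq (NormedSpace.inclusionInDoubleDual ℝ (StrongDual ℝ X) f)
  have hval : ∀ x : X, z (NormedSpace.inclusionInDoubleDual ℝ X x) = f x := fun x => by
    have h1 := DFunLike.congr_fun hzw (NormedSpace.inclusionInDoubleDual ℝ X x)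
    have h2 : w (NormedSpace.inclusionInDoubleDual ℝ X x) = 0 := hw _ ⟨x, rfl⟩
    rw [add_apply, h2, add_zero] at h1
    rw [h1]
    rfl
  have hle : ‖f‖ ≤ ‖z‖ := f.opNorm_le_bound (norm_nonneg z) fun x => by
    rw [← hval x]
    exact z.le_opNorm_of_le (NormedSpace.double_dual_bound ℝ X x)
  have hle' := NormedSpace.double_dual_bound ℝ (StrongDual ℝ X) f
  have hw0 : w = 0 := norm_le_zero_iff.mp (by linarith)
  rwa [← hzw, hw0, add_zero]

lemma IsLSum.isOneNorming_bidual {X : Type*} [NormedAddCommGroup X] [NormedSpace ℝ X]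
    {Z : Submodule ℝ (StrongDual ℝ (StrongDual ℝ (StrongDual ℝ X)))}
    (h : IsLSum Z (topAnnihilator (X := StrongDual ℝ (StrongDual ℝ X)) (canonicalImage X))) : 
    IsOneNorming (X := StrongDual ℝ (StrongDual ℝ X)) Z := by
  intro F
  constructor
  · rintro _ ⟨φ, -, hφ, rfl⟩
    simpa using φ.le_of_opNorm_le hφ F
  · intro b hb
    by_contra! hlt
    obtain ⟨f, hf, hfF⟩ := exists_norm_lt_one_lt_apply F hlt
    have h1 : |F f| ≤ b := hb ⟨_, h.inclusionInDoubleDual_mem f,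
      (NormedSpace.double_dual_bound ℝ (StrongDual ℝ X) f).trans hf.le, rfl⟩
    linarith [le_abs_self (F f)]

theorem theorem4p10 {X : Type*} [NormedAddCommGroup X] [NormedSpace ℝ X] [CompleteSpace X] :
    (∀ (Y : Submodule ℝ X) (Z : Submodule ℝ (StrongDual ℝ X)),
      IsClosed (Y : Set X) → Y ≠ ⊤ → IsLSum Z (topAnnihilator Y) → IsOneNorming Z →
      StrongDiameterTwo X ∧ StrongDiameterTwo Y) ∧
    (IsMEmbedded X → canonicalImage X ≠ ⊤ →
      StrongDiameterTwo X ∧ StrongDiameterTwo (StrongDual ℝ (StrongDual ℝ X))) := by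
  constructor
  · intro Y Z hY hYtop h hZ
    have hYd := h.approxStrongDiameterTwo_subspace hY hYtop hZ
    exact ⟨(h.approxStrongDiameterTwo hYd).strongDiameterTwo, hYd.strongDiameterTwo⟩
  · rintro ⟨hcl, Z, h⟩ htop
    have h : IsLSum Z (topAnnihilator (X := StrongDual ℝ (StrongDual ℝ X)) (canonicalImage X)) := h
    have hYd := h.approxStrongDiameterTwo_subspace hcl htop h.isOneNorming_bidual
    refine ⟨?_, (h.approxStrongDiameterTwo hYd).strongDiameterTwo⟩
    exact StrongDiameterTwo.of_range (W := StrongDual ℝ (StrongDual ℝ X)) (Y := canonicalImage X)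
      (NormedSpace.inclusionInDoubleDualLi ℝ) (fun _ => Iff.rfl) hYd.strongDiameterTwo
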